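/- Let $A$ be a unital $C^*$-algebra, let $\rho$ be a pure state of $A$ (an extreme point of the set of states), and let $R\subseteq A$ be a family of mutually commuting self-adjoint elements. Write $R'$ for the commutant of $R$, and say that a unitary $U\in A$ fixes $\rho$ if $\rho(U^*aU)=\rho(a)$ for all $a\in A$. A dispersion-free state of a unital $C^*$-subalgebra $B\subseteq A$ is a state $\omega$ of $B$ with $\omega(XY)=\omega(X)\omega(Y)$ for all $X,Y\in B$. The algebra $B$ is *beable for* $\rho$ if $\rho|_B$ is a mixture of dispersion-free states, i.e. there is a Borel probability measure $\mu$ on the space $\mathcal S$ of dispersion-free states of $B$ (with the weak-$*$ topology) such that $\rho(b)=\int_{\mathcal S}\omega(b)\,d\mu(\omega)$ for all $b\in B$. It is *$R$-beable for* $\rho$ if it is beable for $\rho$, $R\subseteq B$, and $UBU^*=B$ for every unitary $U\in A$ with $U\in R'$ that fixes $\rho$. Let $(\pi_\rho,H_\rho,x_\rho)$ be the GNS representation of $A$ induced by $\rho$, let $\mathrm{VN}(\pi_\rho(R))=\pi_\rho(R)''$ be the von Neumann algebra generated by $\pi_\rho(R)$, let $S\subseteq H_\rho$ be the closed linear span of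 $\pi_\rho(R)''x_\rho$ with orthogonal projection $P_S$, and put $$B(\pi_\rho(R),x_\rho)=L(S^\perp)\oplus \mathrm{VN}(\pi_\rho(R))P_S\subseteq L(H_\rho),\qquad B(R,\rho)=\pi_\rho^{-1}\bigl[B(\pi_\rho(R),x_\rho)\bigr].$$ Then $B(R,\rho)$ is a unital $C^*$-subalgebra of $A$ which is $R$-beable for $\rho$. Moreover, every unitary $U\in A$ with $U\in R'$ that fixes $\rho$ belongs to $B(R,\rho)$. -/

import Mathlib

open scoped ComplexOrder

namespace BeableAlgebra

open MeasureTheory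

/-! ### States and dispersion-free states -/

section States

variable {B : Type*} [Ring B] [StarRing B] [Algebra ℂ B]

/-- A state of a unital C⋆-algebra: a positive linear functional normalised by `φ 1 = 1`
(equivalently, of norm one). The positive elements of a C⋆-algebra are the `star b * b`. -/
structure IsState (φ : B →ₗ[ℂ] ℂ) : Prop where
  map_one : φ 1 = 1
  nonneg : ∀ b : B, 0 ≤ φ (star b * b)

/-- A pure state: an extreme point of the convex set of all states. -/
def IsPureState (φ : B →ₗ[ℂ] ℂ) : Prop :=
  φ ∈ Set.extremePoints ℝ {ψ : B →ₗ[ℂ] ℂ | IsState ψ}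

/-- The definite algebra of `ω`: the elements on which `ω` is dispersion-free. -/
def definiteAlgebra (ω : B →ₗ[ℂ] ℂ) : Set B :=
  {X | ∀ Y : B, ω (X * Y) = ω X * ω Y}

end States

variable {A : Type*} [CStarAlgebra A]

/-- The space of dispersion-free states of the subalgebra `B`, with the weak-⋆ topology. -/
abbrev DispersionFreeState (B : StarSubalgebra ℂ A) : Type _ :=
  {ω : WeakDual ℂ B //
    IsState (ω : B →L[ℂ] ℂ).toLinearMap ∧
      ∀ X : B, X ∈ definiteAlgebra (ω : B →L[ℂ] ℂ).toLinearMap}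

/-- The Borel σ-algebra of the weak-⋆ topology. -/
noncomputable instance (B : StarSubalgebra ℂ A) : MeasurableSpace (DispersionFreeState B) :=
  borel _

instance (B : StarSubalgebra ℂ A) : BorelSpace (DispersionFreeState B) := ⟨rfl⟩

section Beable

variable [PartialOrder A]

/-- `B` is beable for `ρ`: the restriction of `ρ` to `B` is a mixture of dispersion-free states
of `B`. -/
def IsBeable (B : StarSubalgebra ℂ A) (ρ : A →ₚ[ℂ] ℂ) : Prop :=
  ∃ μ : Measure (DispersionFreeState B), IsProbabilityMeasure μ ∧
    ∀ b : B, Integrable (fun ω : DispersionFreeState B => ω.1 b) μ ∧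
      ρ (b : A) = ∫ ω : DispersionFreeState B, ω.1 b ∂μ

/-- `U` fixes `ρ`, that is, `ρ (U⋆ a U) = ρ a` for all `a`. -/
def Fixes (U : A) (ρ : A →ₚ[ℂ] ℂ) : Prop :=
  ∀ a : A, ρ (star U * a * U) = ρ a

/-- `B` is a C⋆-subalgebra that is `R`-beable for `ρ`. -/
structure IsRBeable (R : Set A) (B : StarSubalgebra ℂ A) (ρ : A →ₚ[ℂ] ℂ) : Prop where
  isClosed : IsClosed (B : Set A)
  beable : IsBeable B ρ
  priv : R ⊆ B
  definable : ∀ U ∈ unitary A, U ∈ Set.centralizer R → Fixes U ρ →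
    (fun b => U * b * star U) '' (B : Set A) = B

end Beable

/-! ### The algebra determined by a family of operators and a vector -/

section Concrete

variable {H : Type*} [NormedAddCommGroup H] [InnerProductSpace ℂ H] [CompleteSpace H]

/-- The von Neumann algebra generated by `R`, i.e. the double commutant of `R ∪ star R`
(which is the double commutant `R''` when `R` consists of self-adjoint operators). -/
noncomputable def vonNeumannGenerated (R : Set (H →L[ℂ] H)) : VonNeumannAlgebra H where
  toStarSubalgebra := StarSubalgebra.centralizer ℂ
    (StarSubalgebra.centralizer ℂ R : Set (H →L[ℂ] H))
  centralizer_centralizer' := by simp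

/-- The closed linear span `[R'' v]` of the vectors `V v`, for `V` in the von Neumann algebra
generated by `R`. -/
noncomputable def cyclicSubspace (R : Set (H →L[ℂ] H)) (v : H) : Submodule ℂ H :=
  (Submodule.span ℂ {y | ∃ V ∈ vonNeumannGenerated R, V v = y}).topologicalClosure

instance (R : Set (H →L[ℂ] H)) (v : H) : CompleteSpace (cyclicSubspace R v) :=
  (Submodule.isClosed_topologicalClosure _).completeSpace_coe

/-- The orthogonal projection of `H` onto `[R'' v]`. -/
noncomputable def cyclicProj (R : Set (H →L[ℂ] H)) (v : H) : H →L[ℂ] H :=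
  (cyclicSubspace R v).starProjection

theorem map_mem_cyclicSubspace {R : Set (H →L[ℂ] H)} {v : H} {V : H →L[ℂ] H}
    (hV : V ∈ vonNeumannGenerated R) {y : H} (hy : y ∈ cyclicSubspace R v) :
    V y ∈ cyclicSubspace R v := by
  refine map_mem_closure V.continuous hy fun z hz => ?_
  refine Submodule.span_induction (p := fun z _ => V z ∈
    Submodule.span ℂ {y | ∃ V ∈ vonNeumannGenerated R, V v = y}) ?_ ?_ ?_ ?_ hz
  · rintro _ ⟨W, hW, rfl⟩
    exact Submodule.subset_span ⟨V * W, mul_mem hV hW, rfl⟩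
  · simp
  · intro x y _ _ hx hy
    rw [map_add]
    exact add_mem hx hy
  · intro c x _ hx
    rw [map_smul]
    exact Submodule.smul_mem _ c hx

theorem isStarProjection_cyclicProj (R : Set (H →L[ℂ] H)) (v : H) :
    IsStarProjection (cyclicProj R v) :=
  isStarProjection_starProjection

theorem cyclicProj_comm {R : Set (H →L[ℂ] H)} {v : H} {V : H →L[ℂ] H}
    (hV : V ∈ vonNeumannGenerated R) : V * cyclicProj R v = cyclicProj R v * V := by
  refine VonNeumannAlgebra.mem_commutant_iff.1 ?_ V hV
  rw [VonNeumannAlgebra.IsStarProjection.mem_iff (isStarProjection_cyclicProj R v)]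
  intro W hW
  rw [VonNeumannAlgebra.commutant_commutant] at hW
  have hr : (cyclicProj R v).range = cyclicSubspace R v := by
    simp [cyclicProj]
  rw [hr, Module.End.mem_invtSubmodule]
  exact fun y hy => map_mem_cyclicSubspace hW hy

/-- With `S = [R'' v]` and `P` the projection onto `S`, this is the algebra
`L(Sᗮ) ⊕ R'' P` of operators on `H`. -/
noncomputable def concreteBeable (R : Set (H →L[ℂ] H)) (v : H) :
    StarSubalgebra ℂ (H →L[ℂ] H) where
  carrier := {T | ∃ X : H →L[ℂ] H, ∃ V ∈ vonNeumannGenerated R,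
    T = (1 - cyclicProj R v) * X * (1 - cyclicProj R v) + V * cyclicProj R v}
  mul_mem' := by
    rintro _ _ ⟨X, V, hV, rfl⟩ ⟨Y, W, hW, rfl⟩
    refine ⟨X * (1 - cyclicProj R v) * Y, V * W, mul_mem hV hW, ?_⟩
    have hP := (isStarProjection_cyclicProj R v).isIdempotentElem.eq
    have hc := cyclicProj_comm (v := v) hW
    generalize cyclicProj R v = P at hP hc ⊢
    have h1 : P * (1 - P) = 0 := by rw [mul_sub, mul_one, hP, sub_self]
    have h2 : (1 - P) * P = 0 := by rw [sub_mul, one_mul, hP, sub_self]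
    have h3 : (1 - P) * (1 - P) = 1 - P := by rw [mul_sub, h2, mul_one, sub_zero]
    calc ((1 - P) * X * (1 - P) + V * P) * ((1 - P) * Y * (1 - P) + W * P)
        = (1 - P) * X * ((1 - P) * (1 - P)) * Y * (1 - P) + (1 - P) * X * ((1 - P) * (W * P))
          + V * (P * (1 - P)) * Y * (1 - P) + V * (P * W) * P := by noncomm_ring
      _ = _ := by
        have h4 : (1 - P) * (W * P) = 0 := by rw [hc, ← mul_assoc, h2, zero_mul]
        rw [h1, h3, h4, ← hc, mul_zero, mul_zero, zero_mul, zero_mul, add_zero, add_zero,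
          mul_assoc V, mul_assoc W, hP]
        simp only [mul_assoc]
  add_mem' := by
    rintro _ _ ⟨X, V, hV, rfl⟩ ⟨Y, W, hW, rfl⟩
    exact ⟨X + Y, V + W, add_mem hV hW, by noncomm_ring⟩
  algebraMap_mem' c := by
    refine ⟨algebraMap ℂ _ c, algebraMap ℂ _ c,
      (vonNeumannGenerated R).toStarSubalgebra.algebraMap_mem c, ?_⟩
    have hP := (isStarProjection_cyclicProj R v).isIdempotentElem.eq
    rw [← Algebra.commutes, mul_assoc, ← mul_add]
    rw [(isStarProjection_cyclicProj R v).isIdempotentElem.one_sub.eq, sub_add_cancel, mul_one]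
  star_mem' := by
    rintro _ ⟨X, V, hV, rfl⟩
    refine ⟨star X, star V, star_mem hV, ?_⟩
    have hs := (isStarProjection_cyclicProj R v).isSelfAdjoint.star_eq
    rw [cyclicProj_comm hV]
    simp only [star_add, star_mul, star_sub, star_one, hs, mul_assoc]

end Concrete

/-! ### The algebra determined by a family of observables and a state -/

section GNS

variable [PartialOrder A] [StarOrderedRing A]

/-- The canonical cyclic vector of the GNS representation of `ρ`: the class of `1`. -/
noncomputable def gnsVector (ρ : A →ₚ[ℂ] ℂ) : ρ.GNS :=
  ((ρ.toPreGNS 1 : ρ.PreGNS) : ρ.GNS)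

/-- The inverse image, under the GNS representation `π` of `ρ` with cyclic vector `x`, of the
algebra determined by `π(R)` and `x`. -/
noncomputable def beableAlgebra (R : Set A) (ρ : A →ₚ[ℂ] ℂ) : StarSubalgebra ℂ A :=
  (concreteBeable (ρ.gnsStarAlgHom '' R) (gnsVector ρ)).comap ρ.gnsStarAlgHom

end GNS

end BeableAlgebra

/-!
Let `π`, `x` be the GNS representation and cyclic vector of the pure state `ρ`. If a unitary `u`
fixes `ρ`, then the functionals `a ↦ ρ ((1 ± u)⋆ a (1 ± u))` are positive and add up to `4 ρ`, so
by extremality both are multiples of `ρ`; doing the same with `i u` gives `ρ (a u) = ρ a * ρ u`.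
Hence `x` is an eigenvector of `π u` and of `π u⋆`. When `u` commutes with `R`, the operator `π u`
therefore acts as a scalar on `S = [π(R)'' x]`, and so `u` belongs to the beable algebra `B`.
Conjugation by an element of `B` preserves `B`.

On `B` the state `ρ` is the vector state at `x ∈ S`, which only sees the restriction of `π(B)` to
`S`, a commutative algebra of operators. Gelfand duality and the Riesz–Markov theorem write `ρ` as
an integral of characters of that algebra, and characters pull back to dispersion-free states of
`B`.

The algebra `B` is norm closed because the reduction `V ↦ V P` of the von Neumann algebra `π(R)''`
is a ⋆-homomorphism, and a ⋆-homomorphism `f` of C⋆-algebras has closed range: truncating a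
self-adjoint `a` at height `‖f a‖` by the functional calculus does not change `f a`, so every
element of the range has a preimage of norm at most twice its own.
-/

namespace BeableAlgebra

section PureStates

variable {B : Type*} [Ring B] [StarRing B] [Algebra ℂ B]

theorem IsState.inv_smul_add {φ ψ : B →ₗ[ℂ] ℂ} (hφ : IsState φ)
    (hψ : ∀ b, 0 ≤ ψ (star b * b)) : IsState ((1 + ψ 1)⁻¹ • (φ + ψ)) := by
  have hψ_one : 0 ≤ ψ 1 := by simpa using hψ 1
  have hpos : 0 < 1 + ψ 1 := add_pos_of_pos_of_nonneg one_pos hψ_one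
  refine ⟨?_, fun b => mul_nonneg (inv_nonneg.2 hpos.le) (add_nonneg (hφ.nonneg b) (hψ b))⟩
  simp only [LinearMap.smul_apply, LinearMap.add_apply, hφ.map_one, smul_eq_mul]
  exact inv_mul_cancel₀ hpos.ne'

theorem IsPureState.eq_smul_of_add_eq_smul {φ : B →ₗ[ℂ] ℂ} (hφ : IsPureState φ)
    {ψ₁ ψ₂ : B →ₗ[ℂ] ℂ} (h₁ : ∀ b, 0 ≤ ψ₁ (star b * b)) (h₂ : ∀ b, 0 ≤ ψ₂ (star b * b))
    {c : ℂ} (hsum : ψ₁ + ψ₂ = c • φ) : ψ₁ = ψ₁ 1 • φ := by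
  obtain ⟨p, hp, hψ₁⟩ := RCLike.nonneg_iff_exists_ofReal.1 (by simpa using h₁ 1 : 0 ≤ ψ₁ 1)
  obtain ⟨q, hq, hψ₂⟩ := RCLike.nonneg_iff_exists_ofReal.1 (by simpa using h₂ 1 : 0 ≤ ψ₂ 1)
  simp only [RCLike.ofReal_eq_complex_ofReal] at hψ₁ hψ₂
  have hc : (p : ℂ) + q = c := by
    simpa [← hψ₁, ← hψ₂, hφ.1.map_one] using LinearMap.congr_fun hsum 1
  have hp' : (1 + p : ℂ) ≠ 0 := by exact_mod_cast (by positivity : 1 + p ≠ 0)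
  have hq' : (1 + q : ℂ) ≠ 0 := by exact_mod_cast (by positivity : 1 + q ≠ 0)
  have hpq : (2 + p + q : ℂ) ≠ 0 := by exact_mod_cast (by positivity : 2 + p + q ≠ 0)
  -- Adding `φ` to both summands keeps the normalising constants away from zero.
  have hmem : φ ∈ openSegment ℝ ((1 + ψ₁ 1)⁻¹ • (φ + ψ₁)) ((1 + ψ₂ 1)⁻¹ • (φ + ψ₂)) := by
    refine ⟨(1 + p) / (2 + p + q), (1 + q) / (2 + p + q), by positivity, by positivity,
      by field_simp; ring, ?_⟩
    ext a
    have ha : ψ₂ a = c * φ a - ψ₁ a :=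
      eq_sub_of_add_eq' (by simpa using LinearMap.congr_fun hsum a)
    simp only [LinearMap.add_apply, LinearMap.smul_apply, smul_eq_mul, Complex.real_smul, ha,
      ← hψ₁, ← hψ₂, ← hc]
    push_cast
    field_simp
    ring
  have heq : (1 + ψ₁ 1)⁻¹ • (φ + ψ₁) = φ :=
    hφ.2 (hφ.1.inv_smul_add h₁) (hφ.1.inv_smul_add h₂) hmem
  rw [inv_smul_eq_iff₀ (by rwa [← hψ₁]), add_smul, one_smul] at heq
  exact add_left_cancel heq

/-- The functional `a ↦ φ (z⋆ a z)`, which is positive when `φ` is. -/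
def conjFunctional (φ : B →ₗ[ℂ] ℂ) (z : B) : B →ₗ[ℂ] ℂ :=
  φ ∘ₗ LinearMap.mulLeftRight ℂ (star z, z)

theorem conjFunctional_apply (φ : B →ₗ[ℂ] ℂ) (z a : B) :
    conjFunctional φ z a = φ (star z * a * z) := rfl

theorem IsState.conjFunctional_nonneg {φ : B →ₗ[ℂ] ℂ} (hφ : IsState φ) (z b : B) :
    0 ≤ conjFunctional φ z (star b * b) := by
  simpa [conjFunctional_apply, mul_assoc] using hφ.nonneg (b * z)

theorem IsPureState.map_mul_add_map_star_mul {φ : B →ₗ[ℂ] ℂ} (hφ : IsPureState φ) {u : B}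
    (hu : ∀ a, φ (star u * a * u) = φ a) (a : B) :
    φ (a * u) + φ (star u * a) = (φ u + φ (star u)) * φ a := by
  have hadd (b : B) : conjFunctional φ (1 + u) b = 2 * φ b + (φ (b * u) + φ (star u * b)) := by
    simp only [conjFunctional_apply, star_add, star_one, add_mul, mul_add, one_mul, mul_one,
      map_add, hu]
    ring
  have hsub (b : B) : conjFunctional φ (1 - u) b = 2 * φ b - (φ (b * u) + φ (star u * b)) := by
    simp only [conjFunctional_apply, star_sub, star_one, sub_mul, mul_sub, one_mul, mul_one,
      map_sub, hu]
    ring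
  have hsum : conjFunctional φ (1 + u) + conjFunctional φ (1 - u) = (4 : ℂ) • φ := by
    ext b
    rw [LinearMap.add_apply, hadd, hsub, LinearMap.smul_apply, smul_eq_mul]
    ring
  have hprop : conjFunctional φ (1 + u) a = conjFunctional φ (1 + u) 1 * φ a :=
    LinearMap.congr_fun (hφ.eq_smul_of_add_eq_smul (hφ.1.conjFunctional_nonneg _)
      (hφ.1.conjFunctional_nonneg _) hsum) a
  rw [hadd, hadd, hφ.1.map_one, one_mul, mul_one, mul_one] at hprop
  linear_combination hprop

theorem IsPureState.map_mul_eq_mul [StarModule ℂ B] {φ : B →ₗ[ℂ] ℂ} (hφ : IsPureState φ) {u : B}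
    (hu : ∀ a, φ (star u * a * u) = φ a) (a : B) : φ (a * u) = φ a * φ u := by
  have hIu (b : B) : φ (star (Complex.I • u) * b * (Complex.I • u)) = φ b := by
    simp [smul_smul, hu]
  have hre := hφ.map_mul_add_map_star_mul hu a
  have him := hφ.map_mul_add_map_star_mul hIu a
  simp only [star_smul, mul_smul_comm, smul_mul_assoc, map_smul, smul_eq_mul, Complex.star_def,
    Complex.conj_I] at him
  linear_combination (1 / 2 : ℂ) * hre - (Complex.I / 2) * him +
    (φ (a * u) - φ (star u * a) - φ u * φ a + φ (star u) * φ a) * (1 / 2) * Complex.I_sq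

theorem IsState.im_eq_zero {φ : B →ₗ[ℂ] ℂ} (hφ : IsState φ) {b : B} (hb : IsSelfAdjoint b) :
    (φ b).im = 0 := by
  have hsq := (Complex.nonneg_iff.1 (hφ.nonneg b)).2
  have hsq_add_one := (Complex.nonneg_iff.1 (hφ.nonneg (b + 1))).2
  simp only [star_add, hb.star_eq, star_one, add_mul, mul_add, one_mul, mul_one, map_add,
    hφ.map_one, Complex.add_im, Complex.one_im] at hsq hsq_add_one
  linarith

end PureStates

section VectorStates

variable {H : Type*} [NormedAddCommGroup H] [InnerProductSpace ℂ H]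

/-- The vector functional `T ↦ ⟪x, T x⟫` on the bounded operators. -/
noncomputable def vectorFunctional (x : H) : (H →L[ℂ] H) →ₗ[ℂ] ℂ where
  toFun T := inner ℂ x (T x)
  map_add' _ _ := inner_add_right _ _ _
  map_smul' _ _ := inner_smul_right _ _ _

theorem vectorFunctional_apply (x : H) (T : H →L[ℂ] H) :
    vectorFunctional x T = inner ℂ x (T x) := rfl

theorem isState_vectorFunctional [CompleteSpace H] {x : H} (hx : ‖x‖ = 1) :
    IsState (vectorFunctional x) := by
  refine ⟨by simp [vectorFunctional_apply, inner_self_eq_norm_sq_to_K, hx], fun T => ?_⟩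
  have : vectorFunctional x (star T * T) = (‖T x‖ ^ 2 : ℝ) := by
    simp [vectorFunctional_apply, ContinuousLinearMap.star_eq_adjoint,
      ContinuousLinearMap.adjoint_inner_right, inner_self_eq_norm_sq_to_K]
  rw [this]
  exact Complex.zero_le_real.2 (sq_nonneg _)

end VectorStates

section Unitary

theorem image_conjugate_eq_of_mem_unitary {A S : Type*} [Monoid A] [StarMul A] [SetLike S A]
    [MulMemClass S A] [StarMemClass S A] {B : S} {u : A} (hu : u ∈ unitary A) (huB : u ∈ B) :
    (fun b => u * b * star u) '' (B : Set A) = B := by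
  ext b
  constructor
  · rintro ⟨c, hc, rfl⟩
    exact mul_mem (mul_mem huB hc) (star_mem huB)
  · intro hb
    refine ⟨star u * b * u, mul_mem (mul_mem (star_mem huB) hb) huB, ?_⟩
    simp only [mul_assoc, Unitary.mul_star_self_of_mem hu, mul_one]
    rw [← mul_assoc, Unitary.mul_star_self_of_mem hu, one_mul]

theorem Fixes.star_of_mem_unitary {A : Type*} [CStarAlgebra A] [PartialOrder A]
    {ρ : A →ₚ[ℂ] ℂ} {u : A} (hfix : Fixes u ρ) (hu : u ∈ unitary A) :
    Fixes (star u) ρ := fun a => by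
  rw [← hfix (star (star u) * a * star u)]
  simp only [star_star, mul_assoc, Unitary.star_mul_self_of_mem hu, mul_one]
  rw [← mul_assoc, Unitary.star_mul_self_of_mem hu, one_mul]

end Unitary

section GNS

variable {A : Type*} [CStarAlgebra A] [PartialOrder A] [StarOrderedRing A] (ρ : A →ₚ[ℂ] ℂ)

theorem gnsStarAlgHom_gnsVector (a : A) :
    ρ.gnsStarAlgHom a (gnsVector ρ) = (ρ.toPreGNS a : ρ.GNS) := by
  simp [gnsVector]

theorem inner_gnsStarAlgHom_gnsVector (a b : A) :
    inner ℂ (ρ.gnsStarAlgHom a (gnsVector ρ)) (ρ.gnsStarAlgHom b (gnsVector ρ)) =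
      ρ (star a * b) := by
  rw [gnsStarAlgHom_gnsVector, gnsStarAlgHom_gnsVector, UniformSpace.Completion.inner_coe,
    PositiveLinearMap.preGNS_inner_def]
  simp

theorem vectorFunctional_gnsVector (a : A) :
    vectorFunctional (gnsVector ρ) (ρ.gnsStarAlgHom a) = ρ a := by
  rw [vectorFunctional_apply]
  have := inner_gnsStarAlgHom_gnsVector ρ 1 a
  rwa [map_one, one_apply_eq_self, star_one, one_mul] at this

variable {ρ}

theorem norm_gnsVector (hone : ρ 1 = 1) : ‖gnsVector ρ‖ = 1 := by
  have h := vectorFunctional_gnsVector ρ 1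
  rw [map_one, hone, vectorFunctional_apply, one_apply_eq_self] at h
  refine (pow_eq_one_iff_of_nonneg (norm_nonneg _) two_ne_zero).1 ?_
  rw [← inner_self_eq_norm_sq (𝕜 := ℂ), h, RCLike.one_re]

theorem gnsStarAlgHom_gnsVector_eq_smul (hone : ρ 1 = 1) {u : A}
    (hu : ρ (star u * u) = ρ (star u) * ρ u) :
    ρ.gnsStarAlgHom u (gnsVector ρ) = ρ u • gnsVector ρ := by
  have hvar : ρ (star (u - ρ u • 1) * (u - ρ u • 1)) = 0 := by
    simp [sub_mul, mul_sub, hu, hone, map_star]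
  rw [← inner_gnsStarAlgHom_gnsVector, inner_self_eq_zero] at hvar
  simpa [sub_eq_zero] using hvar

theorem IsPureState.gnsStarAlgHom_gnsVector_eq_smul (hρ : IsPureState ρ.toLinearMap) {u : A}
    (hfix : Fixes u ρ) : ρ.gnsStarAlgHom u (gnsVector ρ) = ρ u • gnsVector ρ :=
  BeableAlgebra.gnsStarAlgHom_gnsVector_eq_smul hρ.1.map_one (hρ.map_mul_eq_mul hfix (star u))

end GNS

section ClosedRange

open scoped CStarAlgebra

variable {A B : Type*} [NonUnitalCStarAlgebra A] [NonUnitalCStarAlgebra B]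

theorem exists_map_eq_norm_le_of_isSelfAdjoint (φ : A →⋆ₙₐ[ℂ] B) {a : A}
    (ha : IsSelfAdjoint a) : ∃ a', φ a' = φ a ∧ ‖a'‖ ≤ ‖φ a‖ := by
  set r := ‖φ a‖
  have hr : 0 ≤ r := norm_nonneg _
  let clamp : ℝ → ℝ := fun t => max (-r) (min r t)
  have hφa : IsSelfAdjoint (φ a) := ha.map φ
  have hclamp : Set.EqOn clamp id (quasispectrum ℝ (φ a)) := fun t ht => by
    have : |t| ≤ r := NonUnitalIsometricContinuousFunctionalCalculus.norm_quasispectrum_le _ ht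
    simp [clamp, (abs_le.1 this).1, (abs_le.1 this).2]
  refine ⟨cfcₙ clamp a, ?_, norm_cfcₙ_le fun t _ => ?_⟩
  · calc φ (cfcₙ clamp a)
        = cfcₙ clamp (φ a) := φ.map_cfcₙ clamp a (by fun_prop) (by simp [clamp, hr])
          (map_continuous φ)
      _ = cfcₙ id (φ a) := cfcₙ_congr hclamp
      _ = φ a := cfcₙ_id ℝ (φ a)
  · exact abs_le.2 ⟨le_max_left _ _, max_le (by linarith) (min_le_left _ _)⟩

theorem exists_map_eq_norm_le (φ : A →⋆ₙₐ[ℂ] B) (a : A) :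
    ∃ a', φ a' = φ a ∧ ‖a'‖ ≤ 2 * ‖φ a‖ := by
  obtain ⟨b, hb, hb_le⟩ := exists_map_eq_norm_le_of_isSelfAdjoint φ (realPart a).2
  obtain ⟨c, hc, hc_le⟩ := exists_map_eq_norm_le_of_isSelfAdjoint φ (imaginaryPart a).2
  refine ⟨b + Complex.I • c, ?_, ?_⟩
  · rw [map_add, map_smul, hb, hc, ← map_smul, ← map_add, realPart_add_I_smul_imaginaryPart]
  · rw [map_realPart] at hb_le
    rw [map_imaginaryPart] at hc_le
    calc ‖b + Complex.I • c‖ ≤ ‖b‖ + ‖c‖ := by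
          simpa [norm_smul] using norm_add_le b (Complex.I • c)
      _ ≤ ‖φ a‖ + ‖φ a‖ := add_le_add (hb_le.trans (realPart.norm_le (φ a)))
          (hc_le.trans (imaginaryPart.norm_le (φ a)))
      _ = 2 * ‖φ a‖ := (two_mul _).symm

theorem isClosed_range_nonUnitalStarAlgHom (φ : A →⋆ₙₐ[ℂ] B) : IsClosed (Set.range φ) := by
  let f : NormedAddGroupHom A B := AddMonoidHom.mkNormedAddGroupHom (φ : A →+ B) 1
    fun a => by simpa using NonUnitalStarAlgHom.norm_apply_le φ a
  have hf : f.SurjectiveOnWith f.range 2 := by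
    rintro _ ⟨a, rfl⟩
    exact exists_map_eq_norm_le φ a
  have hclosure := controlled_closure_of_complete two_pos one_pos hf
  refine isClosed_of_closure_subset fun b hb => ?_
  obtain ⟨a, ha, -⟩ := hclosure b hb
  exact ⟨a, ha⟩

end ClosedRange

section Reduction

/-- The reduction `a ↦ a p` of a ⋆-subalgebra by a projection `p` commuting with it. -/
def reduction {E : Type*} [Ring E] [StarRing E] [Algebra ℂ E] [StarModule ℂ E]
    (M : StarSubalgebra ℂ E) {p : E} (hp : IsStarProjection p) (hM : ∀ a ∈ M, Commute a p) :
    M →⋆ₙₐ[ℂ] E where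
  toFun a := a * p
  map_smul' c a := smul_mul_assoc c (a : E) p
  map_zero' := zero_mul p
  map_add' a b := add_mul (a : E) b p
  map_mul' a b := by
    rw [MulMemClass.coe_mul, (hM b b.2).symm.mul_mul_mul_comm, hp.isIdempotentElem.eq]
  map_star' a := by
    rw [StarMemClass.coe_star, star_mul, hp.isSelfAdjoint.star_eq, (hM _ (star_mem a.2)).eq]

theorem isClosed_image_mul_right {E : Type*} [CStarAlgebra E] {M : StarSubalgebra ℂ E}
    (hMc : IsClosed (M : Set E)) {p : E} (hp : IsStarProjection p) (hM : ∀ a ∈ M, Commute a p) :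
    IsClosed ((· * p) '' (M : Set E)) := by
  rw [Set.image_eq_range]
  exact isClosed_range_nonUnitalStarAlgHom (reduction M hp hM)

end Reduction

section NormalFamily

variable {E : Type*} [CStarAlgebra E] {R : Set E}

theorem mem_starCentralizer_iff_of_isStarNormal (hR : ∀ a ∈ R, IsStarNormal a) {b : E} :
    b ∈ StarSubalgebra.centralizer ℂ R ↔ b ∈ Set.centralizer R := by
  rw [StarSubalgebra.mem_centralizer_iff]
  exact ⟨fun h a ha => (h a ha).1, fun h a ha => ⟨h a ha, (hR a ha).commute_star_left (h a ha)⟩⟩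

end NormalFamily

section Concrete

variable {H : Type*} [NormedAddCommGroup H] [InnerProductSpace ℂ H] [CompleteSpace H]

theorem isClosed_vonNeumannAlgebra (M : VonNeumannAlgebra H) : IsClosed (M : Set (H →L[ℂ] H)) := by
  rw [← M.centralizer_centralizer]
  exact Set.isClosed_centralizer _

variable {R : Set (H →L[ℂ] H)} {v : H} {S T V W : H →L[ℂ] H}

theorem commute_of_mem_vonNeumannGenerated (hT : T ∈ StarSubalgebra.centralizer ℂ R)
    (hV : V ∈ vonNeumannGenerated R) : Commute T V :=
  ((StarSubalgebra.mem_centralizer_iff ℂ).1 hV T hT).1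

theorem subset_vonNeumannGenerated (R : Set (H →L[ℂ] H)) : R ⊆ vonNeumannGenerated R := by
  refine fun r hr => (StarSubalgebra.mem_centralizer_iff ℂ).2 fun T hT => ?_
  exact ⟨((StarSubalgebra.mem_centralizer_iff ℂ).1 hT r hr).1.symm,
    ((StarSubalgebra.mem_centralizer_iff ℂ).1 (star_mem hT) r hr).1.symm⟩

theorem commute_vonNeumannGenerated (hR : ∀ a ∈ R, IsStarNormal a)
    (hcomm : ∀ a ∈ R, ∀ b ∈ R, Commute a b) (hV : V ∈ vonNeumannGenerated R)
    (hW : W ∈ vonNeumannGenerated R) : Commute V W := by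
  refine commute_of_mem_vonNeumannGenerated
    ((mem_starCentralizer_iff_of_isStarNormal hR).2 fun r hr => ?_) hW
  exact commute_of_mem_vonNeumannGenerated
    ((mem_starCentralizer_iff_of_isStarNormal hR).2 fun s hs => hcomm s hs r hr) hV

theorem mem_cyclicSubspace (R : Set (H →L[ℂ] H)) (v : H) : v ∈ cyclicSubspace R v :=
  Submodule.le_topologicalClosure _ (Submodule.subset_span ⟨1, one_mem _, rfl⟩)

theorem cyclicProj_apply_of_mem {y : H} (hy : y ∈ cyclicSubspace R v) : cyclicProj R v y = y :=
  Submodule.starProjection_eq_self_iff.2 hy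

theorem mul_cyclicProj_eq_of_forall_apply_eq
    (h : ∀ V ∈ vonNeumannGenerated R, S (V v) = T (V v)) :
    S * cyclicProj R v = T * cyclicProj R v := by
  have hle : cyclicSubspace R v ≤ (S - T).ker := by
    refine Submodule.topologicalClosure_minimal _ (Submodule.span_le.2 ?_)
      (ContinuousLinearMap.isClosed_ker _)
    rintro _ ⟨V, hV, rfl⟩
    simpa [sub_eq_zero] using h V hV
  ext y
  simpa [sub_eq_zero, cyclicProj] using
    hle (Submodule.starProjection_apply_mem (cyclicSubspace R v) y)

theorem mul_cyclicProj_eq_smul {c : ℂ} (hT : T ∈ StarSubalgebra.centralizer ℂ R)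
    (hv : T v = c • v) : T * cyclicProj R v = c • cyclicProj R v := by
  rw [← smul_one_mul]
  refine mul_cyclicProj_eq_of_forall_apply_eq fun V hV => ?_
  simpa [hv] using congr($((commute_of_mem_vonNeumannGenerated hT hV).eq) v)

theorem mem_concreteBeable_iff : T ∈ concreteBeable R v ↔ Commute T (cyclicProj R v) ∧
    ∃ V ∈ vonNeumannGenerated R, V * cyclicProj R v = T * cyclicProj R v := by
  have hP := (isStarProjection_cyclicProj R v).isIdempotentElem
  constructor
  · rintro ⟨X, V, hV, rfl⟩
    have hVP : Commute V (cyclicProj R v) := cyclicProj_comm hV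
    generalize cyclicProj R v = P at hP hVP ⊢
    have hright : ((1 - P) * X * (1 - P) + V * P) * P = V * P := by
      rw [add_mul, mul_assoc _ (1 - P), hP.one_sub_mul_self, mul_zero, zero_add, mul_assoc, hP.eq]
    have hleft : P * ((1 - P) * X * (1 - P) + V * P) = V * P := by
      rw [mul_add, mul_assoc (1 - P), ← mul_assoc P, hP.mul_one_sub_self, zero_mul, zero_add,
        ← mul_assoc, ← hVP.eq, mul_assoc, hP.eq]
    exact ⟨hright.trans hleft.symm, V, hV, hright.symm⟩
  · rintro ⟨hTP, V, hV, hVT⟩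
    refine ⟨T, V, hV, ?_⟩
    rw [hVT, one_sub_mul, ← hTP, ← mul_one_sub, mul_assoc, hP.one_sub.eq, mul_one_sub,
      sub_add_cancel]

theorem isClosed_concreteBeable (R : Set (H →L[ℂ] H)) (v : H) :
    IsClosed (concreteBeable R v : Set (H →L[ℂ] H)) := by
  have hcommute : IsClosed {T | Commute T (cyclicProj R v)} :=
    isClosed_eq (continuous_mul_const _) (continuous_const_mul _)
  have hreduced : IsClosed ((· * cyclicProj R v) '' (vonNeumannGenerated R : Set (H →L[ℂ] H))) :=
    isClosed_image_mul_right (M := (vonNeumannGenerated R).toStarSubalgebra)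
      (isClosed_vonNeumannAlgebra _) (isStarProjection_cyclicProj R v)
      fun _ hV => cyclicProj_comm hV
  convert hcommute.inter (hreduced.preimage (continuous_mul_const (cyclicProj R v)))
  ext T
  exact mem_concreteBeable_iff

theorem mem_concreteBeable_of_mem_vonNeumannGenerated (hV : V ∈ vonNeumannGenerated R) (v : H) :
    V ∈ concreteBeable R v :=
  mem_concreteBeable_iff.2 ⟨cyclicProj_comm hV, V, hV, rfl⟩

theorem mem_concreteBeable_of_apply_eq_smul {c d : ℂ} (hT : T ∈ StarSubalgebra.centralizer ℂ R)
    (hv : T v = c • v) (hv_star : star T v = d • v) : T ∈ concreteBeable R v := by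
  have hP := isStarProjection_cyclicProj R v
  have hTP := mul_cyclicProj_eq_smul hT hv
  have hPT := congr(star $(mul_cyclicProj_eq_smul (star_mem hT) hv_star))
  rw [star_mul, star_star, hP.isSelfAdjoint.star_eq, star_smul, hP.isSelfAdjoint.star_eq] at hPT
  have hcommute : T * cyclicProj R v = cyclicProj R v * T :=
    calc T * cyclicProj R v = cyclicProj R v * (T * cyclicProj R v) := by
          rw [hTP, mul_smul_comm, hP.isIdempotentElem.eq]
      _ = cyclicProj R v * T := by
          rw [← mul_assoc, hPT, smul_mul_assoc, hP.isIdempotentElem.eq]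
  refine mem_concreteBeable_iff.2 ⟨hcommute, c • 1, ?_, by rw [smul_one_mul, hTP]⟩
  exact (vonNeumannGenerated R).toStarSubalgebra.smul_mem (one_mem _) c

theorem exists_mem_vonNeumannGenerated_forall_apply_eq (hT : T ∈ concreteBeable R v) :
    ∃ V ∈ vonNeumannGenerated R, ∀ y ∈ cyclicSubspace R v, T y = V y := by
  obtain ⟨-, V, hV, hVT⟩ := mem_concreteBeable_iff.1 hT
  refine ⟨V, hV, fun y hy => ?_⟩
  simpa [cyclicProj_apply_of_mem hy] using congr($hVT.symm y)

theorem apply_mem_cyclicSubspace (hT : T ∈ concreteBeable R v) {y : H}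
    (hy : y ∈ cyclicSubspace R v) : T y ∈ cyclicSubspace R v := by
  obtain ⟨V, hV, hTV⟩ := exists_mem_vonNeumannGenerated_forall_apply_eq hT
  exact hTV y hy ▸ map_mem_cyclicSubspace hV hy

end Concrete

section Restriction

variable {H : Type*} [NormedAddCommGroup H] [InnerProductSpace ℂ H] [CompleteSpace H]

/-- Restriction of a ⋆-algebra of operators to an invariant subspace `S`, encoded as the
compression by the orthogonal projection onto `S`. -/
noncomputable def restrictInvariant (S : Submodule ℂ H) [CompleteSpace S]
    (C : StarSubalgebra ℂ (H →L[ℂ] H)) (hC : ∀ T ∈ C, ∀ y ∈ S, T y ∈ S) :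
    C →⋆ₐ[ℂ] (S →L[ℂ] S) where
  toFun T := S.orthogonalProjectionOnto ∘L T.1 ∘L S.subtypeL
  map_one' := by
    ext y
    simp
  map_mul' T T' := by
    ext y
    have hT' : ((S.orthogonalProjectionOnto (T'.1 y) : S) : H) = T'.1 y :=
      Submodule.starProjection_eq_self_iff.2 (hC T'.1 T'.2 y y.2)
    simp [hT']
  map_zero' := by
    ext y
    simp
  map_add' T T' := by
    ext y
    simp
  commutes' c := by
    ext y
    simp [Algebra.algebraMap_eq_smul_one]
  map_star' T := by
    rw [ContinuousLinearMap.star_eq_adjoint, ContinuousLinearMap.adjoint_comp,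
      ContinuousLinearMap.adjoint_comp, Submodule.adjoint_subtypeL,
      Submodule.adjoint_orthogonalProjectionOnto]
    rfl

theorem coe_restrictInvariant_apply {S : Submodule ℂ H} [CompleteSpace S]
    {C : StarSubalgebra ℂ (H →L[ℂ] H)} (hC : ∀ T ∈ C, ∀ y ∈ S, T y ∈ S) (T : C) (y : S) :
    (restrictInvariant S C hC T y : H) = T.1 y :=
  Submodule.starProjection_eq_self_iff.2 (hC T.1 T.2 y y.2)

/-- The restriction of the operators in `concreteBeable R v` to `cyclicSubspace R v`. Its range
is the reduced algebra `R'' P`. -/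
noncomputable def restrictCyclic (R : Set (H →L[ℂ] H)) (v : H) :
    concreteBeable R v →⋆ₐ[ℂ] (cyclicSubspace R v →L[ℂ] cyclicSubspace R v) :=
  restrictInvariant (cyclicSubspace R v) (concreteBeable R v) fun _ hT _ hy =>
    apply_mem_cyclicSubspace hT hy

theorem coe_restrictCyclic_apply {R : Set (H →L[ℂ] H)} {v : H} (T : concreteBeable R v)
    (y : cyclicSubspace R v) : (restrictCyclic R v T y : H) = T.1 y :=
  coe_restrictInvariant_apply _ T y

theorem commute_restrictCyclic {R : Set (H →L[ℂ] H)} {v : H}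
    (hM : ∀ V ∈ vonNeumannGenerated R, ∀ W ∈ vonNeumannGenerated R, Commute V W)
    (S T : concreteBeable R v) : Commute (restrictCyclic R v S) (restrictCyclic R v T) := by
  obtain ⟨V, hV, hSV⟩ := exists_mem_vonNeumannGenerated_forall_apply_eq S.2
  obtain ⟨W, hW, hTW⟩ := exists_mem_vonNeumannGenerated_forall_apply_eq T.2
  have hS (z) : (restrictCyclic R v S z : H) = V z :=
    (coe_restrictCyclic_apply S z).trans (hSV z z.2)
  have hT (z) : (restrictCyclic R v T z : H) = W z :=
    (coe_restrictCyclic_apply T z).trans (hTW z z.2)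
  ext y
  rw [mul_apply_eq_comp, mul_apply_eq_comp, hS, hT, hT, hS]
  exact congr($((hM V hV W hW).eq) (y : H))

end Restriction

section Riesz

open MeasureTheory
open scoped CompactlySupported

variable {X : Type*} [TopologicalSpace X]

theorem IsState.re_map_realToRCLike_nonneg {φ : C(X, ℂ) →ₗ[ℂ] ℂ} (hφ : IsState φ) {g : C(X, ℝ)}
    (hg : 0 ≤ g) : 0 ≤ (φ (g.realToRCLike ℂ)).re := by
  let s : C(X, ℂ) := ContinuousMap.realToRCLike ℂ ⟨fun x => √(g x), by fun_prop⟩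
  have hs : g.realToRCLike ℂ = star s * s := by
    ext x
    simpa [s] using congrArg Complex.ofReal (Real.mul_self_sqrt (hg x)).symm
  rw [hs]
  exact (Complex.nonneg_iff.1 (hφ.nonneg s)).1

/-- The positive functional `g ↦ φ g` on real-valued functions, for `φ` a state of `C(X, ℂ)`. -/
noncomputable def IsState.realFunctional {φ : C(X, ℂ) →ₗ[ℂ] ℂ} (hφ : IsState φ) :
    C_c(X, ℝ) →ₚ[ℝ] ℝ :=
  .mk₀
    { toFun := fun g => (φ (g.toContinuousMap.realToRCLike ℂ)).re
      map_add' := fun g h => by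
        have hadd : (g + h).toContinuousMap.realToRCLike ℂ =
            g.toContinuousMap.realToRCLike ℂ + h.toContinuousMap.realToRCLike ℂ := by
          ext x
          simp
        rw [hadd, map_add, Complex.add_re]
      map_smul' := fun c g => by
        have hsmul : (c • g).toContinuousMap.realToRCLike ℂ =
            (c : ℂ) • g.toContinuousMap.realToRCLike ℂ := by
          ext x
          simp
        rw [hsmul, map_smul, smul_eq_mul, Complex.re_ofReal_mul, RingHom.id_apply, smul_eq_mul] }
    fun _ hg => hφ.re_map_realToRCLike_nonneg hg

theorem IsState.realFunctional_apply {φ : C(X, ℂ) →ₗ[ℂ] ℂ} (hφ : IsState φ) (g : C_c(X, ℝ)) :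
    (hφ.realFunctional g : ℂ) = φ (g.toContinuousMap.realToRCLike ℂ) :=
  Complex.ext rfl (hφ.im_eq_zero (ContinuousMap.isSelfAdjoint_realToRCLike ℂ)).symm

variable [CompactSpace X] [T2Space X] [MeasurableSpace X] [BorelSpace X]

theorem IsState.map_realToRCLike_eq_integral {φ : C(X, ℂ) →ₗ[ℂ] ℂ} (hφ : IsState φ)
    (g : C(X, ℝ)) :
    φ (g.realToRCLike ℂ) = ∫ x, (g x : ℂ) ∂(RealRMK.rieszMeasure hφ.realFunctional) := by
  let g' : C_c(X, ℝ) := ⟨g, HasCompactSupport.of_compactSpace _⟩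
  calc φ (g.realToRCLike ℂ) = hφ.realFunctional g' := (hφ.realFunctional_apply g').symm
    _ = (∫ x, g x ∂(RealRMK.rieszMeasure hφ.realFunctional) : ℝ) :=
      congrArg _ (RealRMK.integral_rieszMeasure _ g').symm
    _ = ∫ x, (g x : ℂ) ∂(RealRMK.rieszMeasure hφ.realFunctional) := integral_ofReal.symm

theorem IsState.exists_isProbabilityMeasure_eq_integral {φ : C(X, ℂ) →ₗ[ℂ] ℂ}
    (hφ : IsState φ) : ∃ μ : Measure X, IsProbabilityMeasure μ ∧ ∀ f, φ f = ∫ x, f x ∂μ := by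
  set μ := RealRMK.rieszMeasure hφ.realFunctional
  have : IsFiniteMeasure μ := ⟨isCompact_univ.measure_lt_top⟩
  have hφμ (f : C(X, ℂ)) : φ f = ∫ x, f x ∂μ := by
    let u : C(X, ℝ) := ⟨fun x => (f x).re, by fun_prop⟩
    let w : C(X, ℝ) := ⟨fun x => (f x).im, by fun_prop⟩
    have hf : f = u.realToRCLike ℂ + Complex.I • w.realToRCLike ℂ := by
      ext x
      simpa [u, w, mul_comm] using (Complex.re_add_im (f x)).symm
    have hf_int : Integrable f μ :=
      f.continuous.integrable_of_hasCompactSupport (HasCompactSupport.of_compactSpace _)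
    conv_lhs => rw [hf]
    rw [map_add, map_smul, hφ.map_realToRCLike_eq_integral, hφ.map_realToRCLike_eq_integral,
      smul_eq_mul, mul_comm, ← integral_re_add_im hf_int]
    simp [u, w, μ, integral_complex_ofReal]
  refine ⟨μ, ⟨?_⟩, hφμ⟩
  have hone := hφμ 1
  simp only [hφ.map_one, ContinuousMap.one_apply, integral_const, Complex.real_smul, mul_one]
    at hone
  rw [← ENNReal.toReal_eq_one_iff, ← measureReal_def]
  exact_mod_cast hone.symm

end Riesz

section Beable

open MeasureTheory WeakDual
open scoped CStarAlgebra

theorem IsState.comp_starAlgHom {B C : Type*} [Ring B] [StarRing B] [Algebra ℂ B] [Ring C]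
    [StarRing C] [Algebra ℂ C] {φ : C →ₗ[ℂ] ℂ} (hφ : IsState φ) (f : B →⋆ₐ[ℂ] C) :
    IsState (φ ∘ₗ f.toAlgHom.toLinearMap) := by
  refine ⟨?_, fun b => ?_⟩
  · change φ (f 1) = 1
    rw [_root_.map_one, hφ.map_one]
  · change 0 ≤ φ (f (star b * b))
    rw [map_mul, map_star]
    exact hφ.nonneg (f b)

theorem IsState.exists_measure_characterSpace {N : Type*} [CommCStarAlgebra N]
    [MeasurableSpace (characterSpace ℂ N)] [BorelSpace (characterSpace ℂ N)]
    {φ : N →ₗ[ℂ] ℂ} (hφ : IsState φ) :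
    ∃ μ : Measure (characterSpace ℂ N), IsProbabilityMeasure μ ∧
      ∀ a, φ a = ∫ χ : characterSpace ℂ N, χ a ∂μ := by
  let e := gelfandStarTransform N
  let e_symm : C(characterSpace ℂ N, ℂ) →⋆ₐ[ℂ] N := e.symm
  obtain ⟨μ, hμ, hφμ⟩ := (hφ.comp_starAlgHom e_symm).exists_isProbabilityMeasure_eq_integral
  refine ⟨μ, hμ, fun a => ?_⟩
  calc φ a = φ (e.symm (e a)) := by rw [e.symm_apply_apply]
    _ = ∫ χ : characterSpace ℂ N, χ a ∂μ := hφμ (e a)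

variable {A : Type*} [CStarAlgebra A] {B : StarSubalgebra ℂ A}

/-- The dispersion-free state obtained by pulling a character back along a ⋆-homomorphism. -/
noncomputable def pullbackCharacter {N : Type*} [CStarAlgebra N] (f : B →⋆ₐ[ℂ] N)
    (hf : Continuous f) (χ : characterSpace ℂ N) : DispersionFreeState B where
  val := (⟨(χ.1 : N →L[ℂ] ℂ).toLinearMap ∘ₗ f.toAlgHom.toLinearMap,
    (map_continuous χ).comp hf⟩ : B →L[ℂ] ℂ)
  property := by
    refine ⟨⟨?_, fun b => ?_⟩, fun b c => ?_⟩
    · change χ (f 1) = 1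
      rw [map_one, map_one]
    · change 0 ≤ χ (f (star b * b))
      rw [map_mul, map_mul, map_star, map_star]
      exact star_mul_self_nonneg _
    · change χ (f (b * c)) = χ (f b) * χ (f c)
      rw [map_mul, map_mul]

theorem continuous_pullbackCharacter {N : Type*} [CStarAlgebra N] (f : B →⋆ₐ[ℂ] N)
    (hf : Continuous f) : Continuous (pullbackCharacter f hf) :=
  .subtype_mk (continuous_of_continuous_eval fun b => (gelfandTransform ℂ N (f b)).continuous) _

variable [PartialOrder A] {ρ : A →ₚ[ℂ] ℂ}

theorem isBeable_of_commCStarAlgebra {N : Type*} [CommCStarAlgebra N] (f : B →⋆ₐ[ℂ] N)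
    (hf : Continuous f) {φ : N →ₗ[ℂ] ℂ} (hφ : IsState φ) (hρ : ∀ b : B, ρ b = φ (f b)) :
    IsBeable B ρ := by
  let _ : MeasurableSpace (characterSpace ℂ N) := borel _
  have : BorelSpace (characterSpace ℂ N) := ⟨rfl⟩
  obtain ⟨μ, hμ, hφμ⟩ := hφ.exists_measure_characterSpace
  have hpull : Measurable (pullbackCharacter f hf) := (continuous_pullbackCharacter f hf).measurable
  have heval (b : B) : Continuous fun ω : DispersionFreeState B => ω.1 b :=
    (eval_continuous b).comp continuous_subtype_val
  refine ⟨μ.map (pullbackCharacter f hf), Measure.isProbabilityMeasure_map hpull.aemeasurable,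
    fun b => ⟨?_, ?_⟩⟩
  · rw [integrable_map_measure (heval b).aestronglyMeasurable hpull.aemeasurable]
    exact (gelfandTransform ℂ N (f b)).continuous.integrable_of_hasCompactSupport
      (HasCompactSupport.of_compactSpace _)
  · rw [integral_map hpull.aemeasurable (heval b).aestronglyMeasurable, hρ]
    exact hφμ (f b)

theorem isBeable_of_commute {E : Type*} [CStarAlgebra E] (f : B →⋆ₐ[ℂ] E) (hf : Continuous f)
    (hcomm : ∀ a b, Commute (f a) (f b)) {φ : E →ₗ[ℂ] ℂ} (hφ : IsState φ)
    (hρ : ∀ b : B, ρ b = φ (f b)) : IsBeable B ρ := by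
  let N := f.range.topologicalClosure
  have hN : IsClosed (N : Set E) := StarSubalgebra.isClosed_topologicalClosure _
  let _ : CommRing N := f.range.commRingTopologicalClosure (by
    rintro ⟨_, a, rfl⟩ ⟨_, b, rfl⟩
    exact Subtype.ext (hcomm a b))
  let _ : CommCStarAlgebra N := { StarSubalgebra.cstarAlgebra N with mul_comm := mul_comm }
  let g : B →⋆ₐ[ℂ] N :=
    f.codRestrict N fun b => StarSubalgebra.le_topologicalClosure _ ⟨b, rfl⟩
  exact isBeable_of_commCStarAlgebra g (hf.subtype_mk _) (hφ.comp_starAlgHom N.subtype) hρ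

theorem isBeable_comap_concreteBeable {H : Type*} [NormedAddCommGroup H] [InnerProductSpace ℂ H]
    [CompleteSpace H] (π : A →⋆ₐ[ℂ] (H →L[ℂ] H)) {x : H} (hx : ‖x‖ = 1)
    (hρ : ∀ a, ρ a = vectorFunctional x (π a)) {R : Set (H →L[ℂ] H)}
    (hM : ∀ V ∈ vonNeumannGenerated R, ∀ W ∈ vonNeumannGenerated R, Commute V W) :
    IsBeable ((concreteBeable R x).comap π) ρ := by
  let π' : (concreteBeable R x).comap π →⋆ₐ[ℂ] concreteBeable R x :=
    (π.comp (StarSubalgebra.subtype _)).codRestrict _ fun b => b.2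
  let f := (restrictCyclic R x).comp π'
  have hf_apply (b) (y) : (f b y : H) = π b y := coe_restrictCyclic_apply (π' b) y
  have hf : Continuous f := by
    have hπ : Continuous fun b : (concreteBeable R x).comap π => π b :=
      (map_continuous π).comp continuous_subtype_val
    exact continuous_const.clm_comp (hπ.clm_comp continuous_const)
  let x' : cyclicSubspace R x := ⟨x, mem_cyclicSubspace R x⟩
  refine isBeable_of_commute f hf (fun a b => commute_restrictCyclic hM (π' a) (π' b))
    (isState_vectorFunctional (x := x') hx) fun b => ?_
  rw [hρ, vectorFunctional_apply, vectorFunctional_apply, Submodule.coe_inner, hf_apply]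

end Beable

section FixingUnitaries

theorem mem_beableAlgebra_of_fixes {A : Type*} [CStarAlgebra A] [PartialOrder A]
    [StarOrderedRing A] {ρ : A →ₚ[ℂ] ℂ} (hρ : IsPureState ρ.toLinearMap) {R : Set A}
    (hR : ∀ a ∈ R, IsStarNormal a) {u : A} (hu : u ∈ unitary A) (huR : u ∈ Set.centralizer R)
    (hfix : Fixes u ρ) : u ∈ beableAlgebra R ρ := by
  have hstar := hρ.gnsStarAlgHom_gnsVector_eq_smul (hfix.star_of_mem_unitary hu)
  rw [map_star] at hstar
  refine mem_concreteBeable_of_apply_eq_smul ?_ (hρ.gnsStarAlgHom_gnsVector_eq_smul hfix) hstar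
  have huR_star := (StarSubalgebra.mem_centralizer_iff ℂ).1
    ((mem_starCentralizer_iff_of_isStarNormal hR).2 huR)
  rw [StarSubalgebra.mem_centralizer_iff, Set.forall_mem_image]
  intro r hr
  rw [← map_star]
  exact ⟨Commute.map (huR_star r hr).1 ρ.gnsStarAlgHom,
    Commute.map (huR_star r hr).2 ρ.gnsStarAlgHom⟩

end FixingUnitaries

end BeableAlgebra

open BeableAlgebra in
theorem mainTheorem10_general {A : Type*} [CStarAlgebra A] [PartialOrder A] [StarOrderedRing A]
    (ρ : A →ₚ[ℂ] ℂ) (hρ : IsPureState ρ.toLinearMap)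
    (R : Set A) (hR : ∀ a ∈ R, IsStarNormal a) (hcomm : ∀ a ∈ R, ∀ b ∈ R, Commute a b) :
    IsRBeable R (beableAlgebra R ρ) ρ ∧
      ∀ U ∈ unitary A, U ∈ Set.centralizer R → Fixes U ρ → U ∈ beableAlgebra R ρ := by
  have hπR : ∀ a ∈ ρ.gnsStarAlgHom '' R, IsStarNormal a :=
    Set.forall_mem_image.2 fun a ha => (hR a ha).map ρ.gnsStarAlgHom
  have hπcomm : ∀ a ∈ ρ.gnsStarAlgHom '' R, ∀ b ∈ ρ.gnsStarAlgHom '' R, Commute a b :=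
    Set.forall_mem_image.2 fun a ha => Set.forall_mem_image.2 fun b hb =>
      (hcomm a ha b hb).map ρ.gnsStarAlgHom
  have hmem : ∀ U ∈ unitary A, U ∈ Set.centralizer R → Fixes U ρ → U ∈ beableAlgebra R ρ :=
    fun U hU hUR hfix => mem_beableAlgebra_of_fixes hρ hR hU hUR hfix
  refine ⟨⟨(isClosed_concreteBeable _ _).preimage (map_continuous ρ.gnsStarAlgHom), ?_, ?_, ?_⟩,
    hmem⟩
  · exact isBeable_comap_concreteBeable ρ.gnsStarAlgHom (norm_gnsVector hρ.1.map_one)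
      (fun a => (vectorFunctional_gnsVector ρ a).symm)
      fun V hV W hW => commute_vonNeumannGenerated hπR hπcomm hV hW
  · exact fun r hr => mem_concreteBeable_of_mem_vonNeumannGenerated
      (subset_vonNeumannGenerated _ (Set.mem_image_of_mem _ hr)) _
  · exact fun U hU hUR hfix => image_conjugate_eq_of_mem_unitary hU (hmem U hU hUR hfix)

theorem mainTheorem10 {A : Type*} [CStarAlgebra A] [PartialOrder A] [StarOrderedRing A]
    (ρ : A →ₚ[ℂ] ℂ) (hρ : BeableAlgebra.IsPureState ρ.toLinearMap)
    (R : Set A) (hsa : ∀ a ∈ R, IsSelfAdjoint a) (hcomm : ∀ a ∈ R, ∀ b ∈ R, Commute a b) :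
    BeableAlgebra.IsRBeable R (BeableAlgebra.beableAlgebra R ρ) ρ ∧
      ∀ U ∈ unitary A, U ∈ Set.centralizer R → BeableAlgebra.Fixes U ρ →
        U ∈ BeableAlgebra.beableAlgebra R ρ :=
  mainTheorem10_general ρ hρ R (fun a ha => (hsa a ha).isStarNormal) hcomm
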